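/- Let $G=(V,E)$ be a finite directed graph (parallel edges allowed) with $n$ vertices and $m$ edges, and let $k$ commodities be given, commodity $i$ having source $s_i$, sink $t_i$ reachable from $s_i$, and demand $d_i\ge 0$. An $s_i$-$t_i$ flow of value $d_i$ is a nonnegative combination, of total weight $d_i$, of (indicator vectors of) simple directed $s_i$-$t_i$ paths; a feasible flow $f=(f^i)_i$ consists of one such flow for every commodity, and $f_e=\sum_i f^i_e$. Every edge has a latency function $l_e$, and the total latency of $f$ is $\mathrm{cost}(f,l)=\sum_{e} f_e\,l_e(f_e)$. For tolls $\tau\in\mathbb R_{\ge 0}^E$, a feasible flow $f$ is an equilibrium with tolls $\tau$ if for every $i$ and all $s_i$-$t_i$ paths $P,Q$ such that $f^i_e>0$ for every $e\in P$, $$\sum_{e\in P}\bigl(l_e(f_e)+\tau_e\bigr)\le\sum_{e\in Q}\bigl(l_e(f_e)+\tau_e\bigr).$$ For $r\in\mathbb N$ and $U\ge 1$, call $l_e$ a standard degree-$r$ polynomial (with parameter $U$) if it is a polynomial of degree at most $r$ with coefficients in $[0,U]$, at least one nonconstant coefficient being at least $1/U$. For such latencies and all tolls $\tau$, equilibria with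 tolls $\tau$ exist and all have the same edge flow $(f_e)_{e\in E}$, denoted $f(l,\tau)$. The latencies $l^*$ are unknown, but there is an oracle that, when queried with tolls $\tau$, returns the equilibrium edge flow $f(l^*,\tau)$ and its total latency $\mathrm{cost}(f(l^*,\tau),l^*)$. Then there is a polynomial $p$ such that for every such network, all $r\in\mathbb N$, $U\ge1$ and $\varepsilon>0$ there is a deterministic adaptive query algorithm (depending on these data, but not on $l^*$) that, for all standard degree-$r$ polynomial latencies $l^*$ with parameter $U$, makes at most $$p\bigl(\mathcal I+\lceil\log_2\lceil 1/\varepsilon\rceil\rceil\bigr),\qquad \mathcal I=n+m+k+r+\lceil\log_2\lceil U\rceil\rceil+\Bigl\lceil\log_2\bigl\lceil\textstyle\sum_i d_i\bigr\rceil\Bigr\rceil,$$ queries to the oracle (with $\lceil\log_2 0\rceil$ read as $0$) and outputs tolls $\tau\in\mathbb R_{\ge 0}^E$ with $$\mathrm{cost}(f(l^*,\tau),l^*)\le \mathrm{cost}(f,l^*)+\varepsilon\quad\text{for every feasible flow } f.$$ -/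

import Mathlib

open scoped NNReal Polynomial

noncomputable section

namespace RoutingGame

/-- `IsWalk src tgt u v p`: the list of edges `p` is a directed walk from `u` to `v`. -/
def IsWalk {V E : Type} (src tgt : E → V) : V → V → List E → Prop
  | u, v, [] => u = v
  | u, v, e :: p => src e = u ∧ IsWalk src tgt (tgt e) v p

/-- A directed path: a directed walk that visits no vertex twice. -/
def IsPath {V E : Type} (src tgt : E → V) (s t : V) (p : List E) : Prop :=
  IsWalk src tgt s t p ∧ (s :: p.map tgt).Nodup

/-- The publicly known part of a multicommodity nonatomic routing game: a directed graph
(parallel edges allowed) and commodities `i : K` with source, sink and demand; every sink is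
reachable from its source. -/
structure Network (V E K : Type) where
  src : E → V
  tgt : E → V
  source : K → V
  sink : K → V
  demand : K → ℝ
  demand_nonneg : ∀ i, 0 ≤ demand i
  reachable : ∀ i, ∃ p, IsPath src tgt (source i) (sink i) p

variable {V E K : Type}

/-- `g` is an `s`-`t` flow of value `d`: a nonnegative combination of `s`-`t` paths
with weights `x P` of total weight `d`. -/
def IsFlow (src tgt : E → V) (s t : V) (d : ℝ) (g : E → ℝ) : Prop :=
  ∃ x : List E →₀ ℝ,
    (∀ P ∈ x.support, IsPath src tgt s t P ∧ 0 ≤ x P) ∧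
    ∑ P ∈ x.support, x P = d ∧
    ∀ e, g e = ∑ P ∈ x.support, Set.indicator {e' | e' ∈ P} (fun _ => x P) e

/-- Feasible multicommodity flows `f = (f i)`. -/
def IsFeasible (N : Network V E K) (f : K → E → ℝ) : Prop :=
  ∀ i, IsFlow N.src N.tgt (N.source i) (N.sink i) (N.demand i) (f i)

/-- The total flow on the edge `e`, over all commodities. -/
def edgeFlow [Fintype K] (f : K → E → ℝ) (e : E) : ℝ := ∑ i, f i e

/-- The total latency `∑ e, x e * l e (x e)` of the edge flow `x`. -/
def cost [Fintype E] (l : E → ℝ[X]) (x : E → ℝ) : ℝ := ∑ e, x e * (l e).eval (x e)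

/-- `f` is a Wardrop equilibrium for the latencies `l` with tolls `τ`. -/
def IsEquilibrium [Fintype K] (N : Network V E K) (l : E → ℝ[X]) (τ : E → ℝ≥0)
    (f : K → E → ℝ) : Prop :=
  IsFeasible N f ∧
  ∀ (i : K) (P Q : List E),
    IsPath N.src N.tgt (N.source i) (N.sink i) P →
    IsPath N.src N.tgt (N.source i) (N.sink i) Q →
    (∀ e ∈ P, 0 < f i e) →
    (P.map fun e => (l e).eval (edgeFlow f e) + (τ e : ℝ)).sum ≤
      (Q.map fun e => (l e).eval (edgeFlow f e) + (τ e : ℝ)).sum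

/-- `x` is the edge flow of some Wardrop equilibrium with tolls `τ`. -/
def IsEquilibriumFlow [Fintype K] (N : Network V E K) (l : E → ℝ[X]) (τ : E → ℝ≥0)
    (x : E → ℝ) : Prop :=
  ∃ f : K → E → ℝ, IsEquilibrium N l τ f ∧ edgeFlow f = x

/-- The equilibrium edge flow induced by the tolls `τ`. -/
def eqFlow [Fintype K] (N : Network V E K) (l : E → ℝ[X]) (τ : E → ℝ≥0) : E → ℝ :=
  Classical.epsilon (IsEquilibriumFlow N l τ)

/-- Standard polynomials of degree at most `r` with size parameter `U`: the coefficients are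
nonnegative and at most `U`, and some nonconstant coefficient is at least `1 / U`. -/
def IsStandard (r : ℕ) (U : ℝ) (p : ℝ[X]) : Prop :=
  p.natDegree ≤ r ∧ (∀ j, 0 ≤ p.coeff j ∧ p.coeff j ≤ U) ∧ ∃ j, 1 ≤ j ∧ 1 / U ≤ p.coeff j

/-- A deterministic adaptive query algorithm: it either outputs tolls, or queries
tolls and continues depending on the returned edge flow and the returned total latency. -/
inductive Algorithm (E : Type) : Type
  | output (τ : E → ℝ≥0) : Algorithm E
  | query (τ : E → ℝ≥0) (next : (E → ℝ) → ℝ → Algorithm E) : Algorithm E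

/-- The tolls that the algorithm outputs when its queries are answered by `O`. -/
def Algorithm.result (O : (E → ℝ≥0) → (E → ℝ) × ℝ) : Algorithm E → (E → ℝ≥0)
  | .output τ => τ
  | .query τ next => (next (O τ).1 (O τ).2).result O

/-- The number of queries that the algorithm makes when they are answered by `O`. -/
def Algorithm.numQueries (O : (E → ℝ≥0) → (E → ℝ) × ℝ) : Algorithm E → ℕ
  | .output _ => 0
  | .query τ next => (next (O τ).1 (O τ).2).numQueries O + 1

/-- The oracle: it answers tolls by the induced equilibrium flow and its total latency. -/
def oracle [Fintype E] [Fintype K] (N : Network V E K) (l : E → ℝ[X]) (τ : E → ℝ≥0) :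
    (E → ℝ) × ℝ :=
  (eqFlow N l τ, cost l (eqFlow N l τ))

/-- The size of the input: numbers of vertices, edges and commodities, the degree bound, and
the binary lengths of the coefficient bound and of the total demand. -/
def inputSize [Fintype V] [Fintype E] [Fintype K] (N : Network V E K) (r : ℕ) (U : ℝ) : ℕ :=
  Fintype.card V + Fintype.card E + Fintype.card K + r + Nat.clog 2 ⌈U⌉₊ +
    Nat.clog 2 ⌈∑ i, N.demand i⌉₊

end RoutingGame

end

/-! Equilibria are the solutions of a variational inequality: `f` is an equilibrium iff it minimizes
the linear cost given by its own latencies plus tolls. Existence follows by minimizing the Beckmann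
potential, uniqueness of the edge flow from strict monotonicity of the latencies.

Call an edge flow `x` supported if it minimizes a linear cost `c` with `c ≥ η > 0`. If the latencies
at `x` were known to be `z`, the tolls `a * c - z` would make tolled costs at `x` equal to `a * c`
and so enforce `x`; a large `a` keeps them nonnegative. For a wrong guess `z`, either the
equilibrium is still close to `x`, or the answer gives a half-space that excludes `z` but contains
the true latencies with a margin (`pow_le_sum_of_toll`). Taking `z` to be a centerpoint
(`exists_centerpoint`) of the remaining grid candidates shrinks their number by the factor `m / (m +
1)` per query, `m` being the number of edges, so polynomially many queries suffice
(`exists_algorithm_search`).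

It remains to find a good target. The total latency is linear in the vector of powers of edge flows,
with the unknown coefficients of the latencies as weights. By `exists_spanner`, at most `m * (r +
1)` supported flows express all others with coefficients in `[-2, 2]`. Enforcing these and reading
off their costs estimates the cost of every supported flow; an approximate minimizer of the estimate
is then enforced (`exists_algorithm_optimize`). Restricting to supported flows costs little, since
minimizing the total latency plus `η` times the flow gives one (`exists_isSupported_cost_le`). -/

namespace RoutingGame

/-! ### Walks, paths and shortest paths -/

section Walks

variable {V E : Type} {src tgt : E → V}

theorem isWalk_append_iff {u w : V} {p q : List E} :
    IsWalk src tgt u w (p ++ q) ↔ ∃ v, IsWalk src tgt u v p ∧ IsWalk src tgt v w q := by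
  induction p generalizing u with
  | nil => simp [IsWalk]
  | cons e p ih => simp [IsWalk, ih, and_assoc]

theorem IsPath.tail {u v : V} {e : E} {p : List E} (h : IsPath src tgt u v (e :: p)) :
    IsPath src tgt (tgt e) v p :=
  ⟨h.1.2, by simpa using (List.nodup_cons.1 h.2).2⟩

theorem IsPath.exists_suffix {a v u : V} {q : List E} (h : IsPath src tgt a v q)
    (hu : u ∈ a :: q.map tgt) : ∃ q', IsPath src tgt u v q' ∧ q'.Sublist q := by
  induction q generalizing a with
  | nil =>
    obtain rfl : u = a := by simpa using hu
    exact ⟨[], h, .refl _⟩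
  | cons e q ih =>
    rcases List.mem_cons.1 hu with rfl | hu
    · exact ⟨_, h, .refl _⟩
    · obtain ⟨q', h₁, h₂⟩ := ih h.tail hu
      exact ⟨q', h₁, h₂.cons _⟩

theorem IsWalk.exists_path {u v : V} {p : List E} (h : IsWalk src tgt u v p) :
    ∃ q, IsPath src tgt u v q ∧ q.Sublist p := by
  induction p generalizing u with
  | nil => exact ⟨[], ⟨h, by simp⟩, .refl _⟩
  | cons e p ih =>
    obtain ⟨q, hq, hqp⟩ := ih h.2
    by_cases hu : u ∈ tgt e :: q.map tgt
    · obtain ⟨q', h₁, h₂⟩ := hq.exists_suffix hu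
      exact ⟨q', h₁, (h₂.trans hqp).cons _⟩
    · exact ⟨e :: q, ⟨⟨h.1, hq.1⟩, List.nodup_cons.2 ⟨hu, hq.2⟩⟩, hqp.cons_cons _⟩

theorem IsPath.nodup {u v : V} {p : List E} (h : IsPath src tgt u v p) : p.Nodup :=
  ((List.nodup_cons.1 h.2).2).of_map _

/-- A path that is cheapest among all paths is cheapest among all walks. -/
theorem IsWalk.le_of_forall_path {c : E → ℝ} (hc : ∀ e, 0 ≤ c e) {s t : V} {W : List E} {a : ℝ}
    (hW : IsWalk src tgt s t W) (h : ∀ Q, IsPath src tgt s t Q → a ≤ (Q.map c).sum) :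
    a ≤ (W.map c).sum := by
  obtain ⟨Q, hQ, hQW⟩ := hW.exists_path
  refine (h Q hQ).trans ((hQW.map c).sum_le_sum ?_)
  simp only [List.mem_map]
  rintro _ ⟨e, -, rfl⟩
  exact hc e

/-- A walk all of whose edges lie on shortest paths from `s` to `t` is a shortest walk to its
endpoint. -/
theorem IsWalk.sum_le_of_forall_mem {c : E → ℝ} (hc : ∀ e, 0 ≤ c e) {s t : V} {P : List E}
    (hP : ∀ e ∈ P, ∃ R, IsPath src tgt s t R ∧ e ∈ R ∧
      ∀ Q, IsPath src tgt s t Q → (R.map c).sum ≤ (Q.map c).sum)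
    {v : V} (hPv : IsWalk src tgt s v P) {W : List E} (hW : IsWalk src tgt s v W) :
    (P.map c).sum ≤ (W.map c).sum := by
  induction P using List.reverseRecOn generalizing v W with
  | nil =>
    simp only [List.map_nil, List.sum_nil]
    refine List.sum_nonneg ?_
    simp only [List.mem_map]
    rintro _ ⟨e, -, rfl⟩
    exact hc e
  | append_singleton P e ih =>
    obtain ⟨u, hPu, he, hev⟩ := isWalk_append_iff.1 hPv
    obtain rfl : tgt e = v := hev
    subst he
    -- Split a shortest path `R` through the last edge `e` as `R₁, e, R₂`. The induction hypothesis
    -- bounds `P` by `R₁`; replacing `R₁, e` by `W` in `R` gives a walk that is no cheaper than `R`.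
    obtain ⟨R, hR, heR, hmin⟩ := hP e (by simp)
    obtain ⟨R₁, R₂, rfl⟩ := List.append_of_mem heR
    obtain ⟨u', hR₁, he', hR₂⟩ := isWalk_append_iff.1 hR.1
    subst he'
    have h₁ := ih (fun e' he' => hP e' (by simp [he'])) hPu hR₁
    have h₂ := IsWalk.le_of_forall_path hc (isWalk_append_iff.2 ⟨_, hW, hR₂⟩) hmin
    simp only [List.map_append, List.sum_append, List.map_cons, List.sum_cons, List.map_nil,
      List.sum_nil] at h₂ ⊢
    linarith

theorem finite_setOf_isPath [Finite V] [Finite E] (s t : V) :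
    {P | IsPath src tgt s t P}.Finite := by
  have := Fintype.ofFinite V
  refine (List.finite_length_le E (Fintype.card V)).subset fun P hP => ?_
  have := hP.2.length_le_card
  simp at this
  show P.length ≤ _
  omega

end Walks

/-! ### Centerpoints and barycentric spanners -/

section Geometry

/-- The centerpoint theorem: some point of the convex hull of a finite set `P` is such that every
open half-space not containing it has at most a fraction `d / (d + 1)` of `P`. -/
theorem exists_centerpoint {ι : Type} [Fintype ι] {P : Finset (ι → ℝ)} (hP : P.Nonempty) :
    ∃ z ∈ convexHull ℝ (P : Set (ι → ℝ)), ∀ w : ι → ℝ,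
      (Fintype.card ι + 1) * (P.filter fun p => 0 < ∑ i, (z i - p i) * w i).card ≤
        Fintype.card ι * P.card := by
  classical
  set m := Fintype.card ι
  set s : Finset (Finset (ι → ℝ)) := P.powerset.filter fun Q => m * P.card < (m + 1) * Q.card
  have hpos := hP.card_pos
  have hmem : ∀ Q, Q ∈ s ↔ Q ⊆ P ∧ m * P.card < (m + 1) * Q.card := fun Q => by simp [s]
  obtain ⟨z, hz⟩ : (⋂ Q ∈ s, convexHull ℝ (Q : Set (ι → ℝ))).Nonempty := by
    refine Convex.helly_theorem' (𝕜 := ℝ) (fun Q _ => convex_convexHull ℝ _) fun I hI hcard => ?_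
    rw [Module.finrank_fintype_fun_eq_card] at hcard
    -- A member of `s` misses fewer than `|P| / (m + 1)` points of `P`, so the complements of `m +
    -- 1` members cannot cover `P`.
    suffices h : ∃ p ∈ P, ∀ Q ∈ I, p ∈ Q by
      obtain ⟨p, -, hp⟩ := h
      exact ⟨p, Set.mem_iInter₂.2 fun Q hQ => subset_convexHull ℝ _ (by simpa using hp Q hQ)⟩
    by_contra! hcon
    have hsub : P ⊆ I.biUnion fun Q => P \ Q := fun p hp => by
      obtain ⟨Q, hQ, hpQ⟩ := hcon p hp
      exact Finset.mem_biUnion.2 ⟨Q, hQ, Finset.mem_sdiff.2 ⟨hp, hpQ⟩⟩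
    have h₁ : P.card ≤ ∑ Q ∈ I, (P \ Q).card :=
      (Finset.card_le_card hsub).trans Finset.card_biUnion_le
    have h₂ : ∀ Q ∈ I, (m + 1) * (P \ Q).card ≤ P.card - 1 := fun Q hQ => by
      obtain ⟨hQP, hQc⟩ := (hmem Q).1 (hI hQ)
      have h₃ := Finset.card_sdiff_add_card_eq_card hQP
      have h₄ : (m + 1) * (P \ Q).card + (m + 1) * Q.card = m * P.card + P.card := by
        rw [← mul_add, h₃]; ring
      omega
    have h₅ : (m + 1) * P.card ≤ (m + 1) * (P.card - 1) := calc
      (m + 1) * P.card ≤ ∑ Q ∈ I, (m + 1) * (P \ Q).card := by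
        rw [← Finset.mul_sum]; gcongr
      _ ≤ I.card * (P.card - 1) := by simpa using Finset.sum_le_card_nsmul _ _ _ h₂
      _ ≤ (m + 1) * (P.card - 1) := by gcongr
    have := Nat.le_of_mul_le_mul_left h₅ (Nat.succ_pos m)
    omega
  rw [Set.mem_iInter₂] at hz
  refine ⟨z, hz P ((hmem P).2 ⟨subset_rfl, by gcongr; omega⟩), fun w => ?_⟩
  by_contra! hcon
  have hzQ := hz _ ((hmem _).2 ⟨Finset.filter_subset _ _, hcon⟩)
  -- The excluded points would form a member of `s`, so `z` would lie in their hull, hence strictly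
  -- on their side of the hyperplane through `z` itself.
  have hlin : IsLinearMap ℝ fun p : ι → ℝ => ∑ i, p i * w i :=
    ⟨fun p q => by simp [add_mul, Finset.sum_add_distrib],
      fun a p => by simp [Finset.mul_sum, mul_assoc]⟩
  have hconv := convex_halfSpace_lt hlin (∑ i, z i * w i)
  have := convexHull_min (fun p hp => ?_) hconv hzQ
  · exact lt_irrefl (∑ i, z i * w i) this
  · have hp := (Finset.mem_filter.1 (Finset.mem_coe.1 hp)).2
    simp only [sub_mul, Finset.sum_sub_distrib] at hp
    exact sub_pos.1 hp

/-- Approximate barycentric spanners: a bounded family in a finite-dimensional space has few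
members such that all members are combinations of them with coefficients in `[-2, 2]`. -/
theorem exists_spanner {X κ : Type} [Fintype κ] (φ : X → κ → ℝ) {C : ℝ} (hC : ∀ x, ‖φ x‖ ≤ C) :
    ∃ n ≤ Fintype.card κ, ∃ y : Fin n → X, ∀ x, ∃ c : Fin n → ℝ,
      (∀ j, |c j| ≤ 2) ∧ φ x = ∑ j, c j • φ (y j) := by
  classical
  -- Determinants are taken in the span of the family, so that some of them do not vanish.
  set W := Submodule.span ℝ (Set.range φ)
  set ψ : X → W := fun x => ⟨φ x, Submodule.subset_span ⟨x, rfl⟩⟩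
  have hψ : Submodule.span ℝ (Set.range ψ) = ⊤ := by
    have h := Submodule.span_span_coe_preimage (R := ℝ) (s := Set.range φ)
    convert h using 2
    ext ⟨w, hw⟩
    simp [ψ]
  obtain ⟨b, hb, hspan, hli⟩ := exists_linearIndependent ℝ (Set.range ψ)
  rw [hψ] at hspan
  have : Finite b := hli.finite
  have := Fintype.ofFinite b
  let e := Module.Basis.mk hli (by simp [hspan])
  have hcard : Fintype.card b ≤ Fintype.card κ := by
    rw [← Module.finrank_eq_card_basis e, ← Module.finrank_fintype_fun_eq_card (R := ℝ)]
    exact Submodule.finrank_le W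
  choose y₀ hy₀ using fun i : b => hb i.2
  have hdet₀ : e.det (fun i => ψ (y₀ i)) = 1 := by
    have : (fun i => ψ (y₀ i)) = e := by
      ext1 i; simp [hy₀, e]
    rw [this, Module.Basis.det_self]
  have hbdd : BddAbove (Set.range fun y : b → X => |e.det fun i => ψ (y i)|) := by
    have hcomp : IsCompact (Set.univ.pi fun _ : b => Metric.closedBall (0 : W) C) :=
      isCompact_univ_pi fun _ => isCompact_closedBall _ _
    have hcont : Continuous fun v : b → W => e.det v := by
      simp only [Module.Basis.det_apply]
      refine Continuous.matrix_det ?_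
      refine continuous_matrix fun i j => ?_
      simp only [Module.Basis.toMatrix_apply]
      exact (LinearMap.continuous_of_finiteDimensional (e.coord i)).comp (continuous_apply j)
    obtain ⟨M, hM⟩ := hcomp.exists_bound_of_continuousOn hcont.continuousOn
    refine ⟨M, ?_⟩
    rintro _ ⟨y, rfl⟩
    exact hM _ fun i _ => by simpa [ψ] using hC (y i)
  set σ := sSup (Set.range fun y : b → X => |e.det fun i => ψ (y i)|)
  have hσ : ∀ y : b → X, |e.det fun i => ψ (y i)| ≤ σ := fun y => le_csSup hbdd ⟨y, rfl⟩
  have hσ1 : 1 ≤ σ := by simpa [hdet₀] using hσ y₀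
  -- The supremum of the determinants need not be attained; stopping within a factor 2 of it gives
  -- the coefficient bound 2.
  obtain ⟨_, ⟨y, rfl⟩, hy⟩ := exists_lt_of_lt_csSup (Set.range_nonempty_iff_nonempty.2 ⟨y₀⟩)
    (show σ / 2 < σ by linarith)
  have hy0 : e.det (fun i => ψ (y i)) ≠ 0 := fun h => by
    simp only [h, abs_zero] at hy; linarith
  obtain ⟨hyli, hysp⟩ := (Module.Basis.is_basis_iff_det e).2 hy0.isUnit
  let ey := Module.Basis.mk hyli hysp.ge
  let eqv := Fintype.equivFin b
  refine ⟨Fintype.card b, hcard, fun j => y (eqv.symm j), fun x =>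
    ⟨fun j => ey.repr (ψ x) (eqv.symm j), fun j => ?_, ?_⟩⟩
  · set i := eqv.symm j
    -- Cramer's rule: the coefficient at `i` is the ratio of the determinants after and before `y i`
    -- is replaced by `x`.
    have h := congrArg (fun f => f (ψ x)) (Module.Basis.det_smul_mk_coord_eq_det_update e hyli hysp.ge i)
    simp only [LinearMap.smul_apply, smul_eq_mul, MultilinearMap.toLinearMap_apply,
      Module.Basis.coord_apply] at h
    have h' : Function.update (fun i => ψ (y i)) i (ψ x) = fun i' => ψ (Function.update y i x i') := by
      ext1 i'
      by_cases hi : i' = i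
      · subst hi; simp
      · simp [hi]
    have h₂ := hσ (Function.update y i x)
    rw [← h'] at h₂
    have h₃ : |e.det fun i => ψ (y i)| * |ey.repr (ψ x) i| ≤ σ := by
      rw [← abs_mul]
      refine le_of_eq_of_le (congrArg _ h) h₂
    by_contra! hlt
    nlinarith [abs_nonneg (e.det fun i => ψ (y i))]
  · have h := congrArg Subtype.val (ey.sum_repr (ψ x))
    rw [Equiv.sum_comp eqv.symm (fun i => ey.repr (ψ x) i • φ (y i))]
    simpa [ey, ψ] using h.symm

end Geometry

/-! ### Single-commodity flows as path weights -/

section Flows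

variable {V E : Type} [Finite V] {src tgt : E → V}

/-- The finite set of all directed paths from `s` to `t`. -/
noncomputable def pathFinset [Finite E] (src tgt : E → V) (s t : V) : Finset (List E) :=
  (finite_setOf_isPath (src := src) (tgt := tgt) s t).toFinset

theorem mem_pathFinset [Finite E] {s t : V} {P : List E} :
    P ∈ pathFinset src tgt s t ↔ IsPath src tgt s t P := by
  simp [pathFinset]

/-- The indicator vector of a path. -/
noncomputable def pathVec (P : List E) : E → ℝ := Set.indicator {e | e ∈ P} fun _ => 1

theorem pathVec_nonneg (P : List E) (e : E) : 0 ≤ pathVec P e :=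
  Set.indicator_nonneg (fun _ _ => zero_le_one) e

theorem pathVec_le_one (P : List E) (e : E) : pathVec P e ≤ 1 :=
  Set.indicator_apply_le' (fun _ => le_rfl) fun _ => zero_le_one

theorem pathVec_of_mem {P : List E} {e : E} (h : e ∈ P) : pathVec P e = 1 :=
  Set.indicator_of_mem (s := {e | e ∈ P}) h _

theorem mem_of_pathVec_ne_zero {P : List E} {e : E} (h : pathVec P e ≠ 0) : e ∈ P :=
  Set.mem_of_indicator_ne_zero (s := {e | e ∈ P}) h

theorem sum_mul_pathVec [Fintype E] (c : E → ℝ) {P : List E} (hP : P.Nodup) :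
    ∑ e, c e * pathVec P e = (P.map c).sum := by
  classical
  rw [← List.sum_toFinset _ hP, ← Finset.sum_subset (Finset.subset_univ P.toFinset)]
  · exact Finset.sum_congr rfl fun e he => by rw [pathVec_of_mem (by simpa using he), mul_one]
  · intro e _ he
    rw [List.mem_toFinset] at he
    rw [by_contra fun h => he (mem_of_pathVec_ne_zero h), mul_zero]

/-- Indexing the weights by the fixed finite set of all paths lets flows be combined and compared
termwise. -/
theorem isFlow_iff [Finite E] {s t : V} {d : ℝ} {g : E → ℝ} :
    IsFlow src tgt s t d g ↔ ∃ w : List E → ℝ, (∀ P ∈ pathFinset src tgt s t, 0 ≤ w P) ∧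
      ∑ P ∈ pathFinset src tgt s t, w P = d ∧
      ∀ e, g e = ∑ P ∈ pathFinset src tgt s t, w P * pathVec P e := by
  classical
  have hind : ∀ (P : List E) (a : ℝ) (e : E),
      Set.indicator {e' | e' ∈ P} (fun _ => a) e = a * pathVec P e := fun P a e => by
    by_cases h : e ∈ P <;> simp [pathVec, h]
  constructor
  · rintro ⟨x, hx, hsum, hg⟩
    have hsub : x.support ⊆ pathFinset src tgt s t := fun P hP => mem_pathFinset.2 (hx P hP).1
    refine ⟨x, fun P _ => ?_, ?_, fun e => ?_⟩
    · by_cases h : P ∈ x.support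
      · exact (hx P h).2
      · rw [Finsupp.notMem_support_iff.1 h]
    · rw [← hsum]
      exact (Finset.sum_subset hsub fun P _ h => Finsupp.notMem_support_iff.1 h).symm
    · rw [hg e]
      simp only [hind]
      exact Finset.sum_subset hsub fun P _ h => by simp [Finsupp.notMem_support_iff.1 h]
  · rintro ⟨w, hw, hsum, hg⟩
    let x : List E →₀ ℝ := Finsupp.onFinset (pathFinset src tgt s t)
      (fun P => if P ∈ pathFinset src tgt s t then w P else 0) (by simp +contextual)
    have hsub : x.support ⊆ pathFinset src tgt s t := Finsupp.support_onFinset_subset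
    have hx : ∀ P ∈ pathFinset src tgt s t, x P = w P := fun P hP => by simp [x, hP]
    refine ⟨x, fun P hP => ⟨mem_pathFinset.1 (hsub hP), ?_⟩, ?_, fun e => ?_⟩
    · rw [hx P (hsub hP)]; exact hw P (hsub hP)
    · rw [← hsum, Finset.sum_subset hsub fun P _ h => Finsupp.notMem_support_iff.1 h]
      exact Finset.sum_congr rfl hx
    · rw [hg e]
      simp only [hind]
      rw [Finset.sum_subset hsub fun P _ h => by simp [Finsupp.notMem_support_iff.1 h]]
      exact Finset.sum_congr rfl fun P hP => by rw [hx P hP]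

theorem isFlow_smul_pathVec [Finite E] {s t : V} {d : ℝ} (hd : 0 ≤ d) {P : List E}
    (hP : IsPath src tgt s t P) : IsFlow src tgt s t d (fun e => d * pathVec P e) := by
  classical
  refine isFlow_iff.2 ⟨fun Q => if Q = P then d else 0, fun Q _ => ?_, ?_, fun e => ?_⟩
  · dsimp only; split_ifs <;> simp [hd]
  · simp [mem_pathFinset.2 hP]
  · simp [mem_pathFinset.2 hP, ite_mul]

theorem IsFlow.mem_Icc [Finite E] {s t : V} {d : ℝ} {g : E → ℝ} (h : IsFlow src tgt s t d g)
    (e : E) : 0 ≤ g e ∧ g e ≤ d := by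
  obtain ⟨w, hw, hsum, hg⟩ := isFlow_iff.1 h
  rw [hg e, ← hsum]
  exact ⟨Finset.sum_nonneg fun P hP => mul_nonneg (hw P hP) (pathVec_nonneg P e),
    Finset.sum_le_sum fun P hP => mul_le_of_le_one_right (hw P hP) (pathVec_le_one P e)⟩

theorem convex_setOf_isFlow [Finite E] (s t : V) (d : ℝ) :
    Convex ℝ {g | IsFlow src tgt s t d g} := by
  intro g hg g' hg' a b ha hb hab
  obtain ⟨w, hw, hsum, hwg⟩ := isFlow_iff.1 hg
  obtain ⟨w', hw', hsum', hwg'⟩ := isFlow_iff.1 hg'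
  refine isFlow_iff.2 ⟨fun P => a * w P + b * w' P, fun P hP => ?_, ?_, fun e => ?_⟩
  · exact add_nonneg (mul_nonneg ha (hw P hP)) (mul_nonneg hb (hw' P hP))
  · rw [Finset.sum_add_distrib, ← Finset.mul_sum, ← Finset.mul_sum, hsum, hsum', ← add_mul, hab,
      one_mul]
  · simp only [Pi.add_apply, Pi.smul_apply, smul_eq_mul, hwg, hwg', Finset.mul_sum,
      ← Finset.sum_add_distrib]
    exact Finset.sum_congr rfl fun P _ => by ring

theorem isCompact_setOf_isFlow [Finite E] (s t : V) (d : ℝ) :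
    IsCompact {g | IsFlow src tgt s t d g} := by
  classical
  set F := pathFinset src tgt s t
  set S : Set (F → ℝ) := {w | (∀ P, 0 ≤ w P) ∧ ∑ P, w P = d}
  have hS : IsCompact S := by
    refine (isCompact_Icc (a := (0 : F → ℝ)) (b := fun _ => d)).of_isClosed_subset ?_ ?_
    · have h₁ : IsClosed {w : F → ℝ | ∀ P, 0 ≤ w P} :=
        isClosed_le (f := fun _ : F → ℝ => (0 : F → ℝ)) continuous_const continuous_id
      have h₂ : IsClosed {w : F → ℝ | ∑ P, w P = d} :=
        isClosed_eq (by fun_prop) continuous_const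
      exact h₁.inter h₂
    · rintro w ⟨hw, hsum⟩
      refine ⟨hw, fun P => ?_⟩
      rw [← hsum]
      exact Finset.single_le_sum (fun Q _ => hw Q) (Finset.mem_univ P)
  have himg : {g | IsFlow src tgt s t d g} =
      (fun (w : F → ℝ) (e : E) => ∑ P, w P * pathVec P.1 e) '' S := by
    ext g
    rw [Set.mem_ofPred_eq, isFlow_iff]
    constructor
    · rintro ⟨w, hw, hsum, hg⟩
      refine ⟨fun P => w P, ⟨fun P => hw P P.2, ?_⟩, ?_⟩
      · rw [← hsum]; exact Finset.sum_coe_sort F w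
      · ext e
        rw [hg e]; exact Finset.sum_coe_sort F fun P => w P * pathVec P e
    · rintro ⟨w, ⟨hw, hsum⟩, rfl⟩
      refine ⟨fun P => if h : P ∈ F then w ⟨P, h⟩ else 0, fun P hP => ?_, ?_, fun e => ?_⟩
      · have hP' : P ∈ F := hP
        simpa [hP'] using hw ⟨P, hP'⟩
      · rw [← hsum, ← Finset.sum_coe_sort F]
        exact Finset.sum_congr rfl fun P _ => by simp
      · rw [← Finset.sum_coe_sort F]
        exact Finset.sum_congr rfl fun P _ => by simp
  rw [himg]
  exact hS.image (by fun_prop)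

/-- Path weights of a flow turn linear costs of the flow into path costs. -/
theorem sum_mul_flow [Fintype E] {s t : V} {w : List E → ℝ} {g : E → ℝ}
    (hg : ∀ e, g e = ∑ P ∈ pathFinset src tgt s t, w P * pathVec P e) (c : E → ℝ) :
    ∑ e, c e * g e = ∑ P ∈ pathFinset src tgt s t, w P * (P.map c).sum := by
  simp only [hg, Finset.mul_sum]
  rw [Finset.sum_comm]
  refine Finset.sum_congr rfl fun P hP => ?_
  rw [← sum_mul_pathVec c (mem_pathFinset.1 hP).nodup, Finset.mul_sum]
  exact Finset.sum_congr rfl fun e _ => by ring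

end Flows

/-! ### Feasible flows and the variational inequality for equilibria -/

section Feasible

variable {V E K : Type} [Fintype V] [Fintype E] (N : Network V E K)

theorem isCompact_setOf_isFeasible : IsCompact {f | IsFeasible N f} := by
  have : {f | IsFeasible N f} = Set.univ.pi fun i =>
      {g | IsFlow N.src N.tgt (N.source i) (N.sink i) (N.demand i) g} := by
    ext f; simp [IsFeasible]
  rw [this]
  exact isCompact_univ_pi fun i => isCompact_setOf_isFlow _ _ _

variable {N}

theorem IsFeasible.add_smul_sub {f g : K → E → ℝ} (hf : IsFeasible N f) (hg : IsFeasible N g)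
    {a : ℝ} (ha : a ∈ Set.Icc (0 : ℝ) 1) : IsFeasible N (f + a • (g - f)) := fun i =>
  (convex_setOf_isFlow _ _ _).add_smul_sub_mem (hf i) (hg i) ha

variable (N) in
theorem exists_isFeasible : ∃ f, IsFeasible N f := by
  choose P hP using N.reachable
  exact ⟨_, fun i => isFlow_smul_pathVec (N.demand_nonneg i) (hP i)⟩

variable [Fintype K]

theorem IsFeasible.edgeFlow_mem_Icc {f : K → E → ℝ} (hf : IsFeasible N f) (e : E) :
    0 ≤ edgeFlow f e ∧ edgeFlow f e ≤ ∑ i, N.demand i :=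
  ⟨Finset.sum_nonneg fun i _ => ((hf i).mem_Icc e).1,
    Finset.sum_le_sum fun i _ => ((hf i).mem_Icc e).2⟩

theorem sum_mul_edgeFlow (c : E → ℝ) (f : K → E → ℝ) :
    ∑ e, c e * edgeFlow f e = ∑ i, ∑ e, c e * f i e := by
  simp only [edgeFlow, Finset.mul_sum]
  exact Finset.sum_comm

/-- A path of positive weight has positive flow on all its edges, so at equilibrium it is a cheapest
path. Any other flow pays at least the cheapest price for every unit of demand. -/
theorem IsEquilibrium.sum_le {l : E → ℝ[X]} {τ : E → ℝ≥0} {f g : K → E → ℝ}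
    (hf : IsEquilibrium N l τ f) (hg : IsFeasible N g) :
    ∑ e, ((l e).eval (edgeFlow f e) + τ e) * edgeFlow f e ≤
      ∑ e, ((l e).eval (edgeFlow f e) + τ e) * edgeFlow g e := by
  rw [sum_mul_edgeFlow, sum_mul_edgeFlow]
  refine Finset.sum_le_sum fun i _ => ?_
  set c : E → ℝ := fun e => (l e).eval (edgeFlow f e) + τ e
  obtain ⟨w, hw, hwsum, hwf⟩ := isFlow_iff.1 (hf.1 i)
  obtain ⟨v, hv, hvsum, hvg⟩ := isFlow_iff.1 (hg i)
  obtain ⟨P₀, hP₀⟩ := N.reachable i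
  obtain ⟨R, hR, hRmin⟩ := Finset.exists_min_image (pathFinset N.src N.tgt (N.source i) (N.sink i))
    (fun P => (P.map c).sum) ⟨P₀, mem_pathFinset.2 hP₀⟩
  rw [sum_mul_flow hwf c, sum_mul_flow hvg c]
  calc _ ≤ ∑ P ∈ pathFinset N.src N.tgt (N.source i) (N.sink i), w P * (R.map c).sum := by
        refine Finset.sum_le_sum fun P hP => ?_
        rcases (hw P hP).eq_or_lt with h | h
        · simp [← h]
        · refine mul_le_mul_of_nonneg_left ?_ h.le
          refine hf.2 i P R (mem_pathFinset.1 hP) (mem_pathFinset.1 hR) fun e he => ?_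
          rw [hwf e]
          refine h.trans_le ?_
          refine le_of_eq_of_le ?_ (Finset.single_le_sum (f := fun P => w P * pathVec P e)
            (fun Q hQ => mul_nonneg (hw Q hQ) (pathVec_nonneg Q e)) hP)
          simp [pathVec_of_mem he]
    _ = ∑ P ∈ pathFinset N.src N.tgt (N.source i) (N.sink i), v P * (R.map c).sum := by
        rw [← Finset.sum_mul, ← Finset.sum_mul, hwsum, hvsum]
    _ ≤ _ := Finset.sum_le_sum fun P hP => mul_le_mul_of_nonneg_left (hRmin P hP) (hv P hP)

theorem isEquilibrium_of_forall_sum_le {l : E → ℝ[X]} {τ : E → ℝ≥0} {f : K → E → ℝ}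
    (hf : IsFeasible N f) (hc : ∀ e, 0 ≤ (l e).eval (edgeFlow f e) + τ e)
    (h : ∀ g, IsFeasible N g → ∑ e, ((l e).eval (edgeFlow f e) + τ e) * edgeFlow f e ≤
      ∑ e, ((l e).eval (edgeFlow f e) + τ e) * edgeFlow g e) :
    IsEquilibrium N l τ f := by
  classical
  refine ⟨hf, fun i P Q hP hQ hpos => ?_⟩
  set c : E → ℝ := fun e => (l e).eval (edgeFlow f e) + τ e
  obtain ⟨w, hw, hwsum, hwf⟩ := isFlow_iff.1 (hf i)
  obtain ⟨R, hR, hRmin⟩ := Finset.exists_min_image (pathFinset N.src N.tgt (N.source i) (N.sink i))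
    (fun P => (P.map c).sum) ⟨P, mem_pathFinset.2 hP⟩
  have hRf := isFlow_smul_pathVec (N.demand_nonneg i) (mem_pathFinset.1 hR)
  -- Compare `f` with the flow that reroutes all of commodity `i` to a cheapest path `R`.
  have hle : ∑ e, c e * f i e ≤ N.demand i * (R.map c).sum := by
    set g : K → E → ℝ := Function.update f i fun e => N.demand i * pathVec R e
    have hg : IsFeasible N g := fun j => by
      by_cases hj : j = i
      · subst hj; simpa [g] using hRf
      · simpa [g, hj] using hf j
    have h₁ := h g hg
    rw [sum_mul_edgeFlow, sum_mul_edgeFlow, ← Finset.add_sum_erase _ _ (Finset.mem_univ i),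
      ← Finset.add_sum_erase (a := i) _ (fun i => ∑ e, c e * g i e) (Finset.mem_univ i)] at h₁
    have h₂ : ∑ j ∈ Finset.univ.erase i, ∑ e, c e * g j e =
        ∑ j ∈ Finset.univ.erase i, ∑ e, c e * f j e :=
      Finset.sum_congr rfl fun j hj => by simp [g, Finset.ne_of_mem_erase hj]
    have h₃ : ∑ e, c e * g i e = N.demand i * (R.map c).sum := by
      rw [← sum_mul_pathVec c (mem_pathFinset.1 hR).nodup, Finset.mul_sum]
      exact Finset.sum_congr rfl fun e _ => by simp [g]; ring
    linarith
  have hshort : ∀ S ∈ pathFinset N.src N.tgt (N.source i) (N.sink i), 0 < w S →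
      (S.map c).sum ≤ (R.map c).sum := by
    intro S hS hwS
    rw [sum_mul_flow hwf c, ← hwsum, Finset.sum_mul] at hle
    by_contra! hlt
    refine absurd hle (not_le.2 (Finset.sum_lt_sum (fun T hT => ?_) ⟨S, hS, ?_⟩))
    · exact mul_le_mul_of_nonneg_left (hRmin T hT) (hw T hT)
    · exact mul_lt_mul_of_pos_left hlt hwS
  -- The path `P` need not have positive weight in the decomposition; it is only known that each of
  -- its edges lies on some path that does.
  refine IsWalk.sum_le_of_forall_mem (t := N.sink i) hc (fun e he => ?_) hP.1 hQ.1
  have hfe := hpos e he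
  rw [hwf e] at hfe
  obtain ⟨S, hS, hSpos⟩ := Finset.exists_lt_of_sum_lt (s := pathFinset N.src N.tgt (N.source i)
    (N.sink i)) (f := fun _ => (0 : ℝ)) (g := fun P => w P * pathVec P e) (by simpa using hfe)
  refine ⟨S, mem_pathFinset.1 hS, mem_of_pathVec_ne_zero fun h0 => by simp [h0] at hSpos,
    fun T hT => ?_⟩
  refine (hshort S hS ?_).trans (hRmin T (mem_pathFinset.2 hT))
  exact pos_of_mul_pos_left hSpos (pathVec_nonneg S e)

/-- A separable polynomial objective has a minimizer over the feasible flows, and it satisfies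
the first-order optimality condition. -/
theorem exists_isFeasible_minimizer (N : Network V E K) (q : E → ℝ[X]) :
    ∃ f, IsFeasible N f ∧
      (∀ g, IsFeasible N g →
        ∑ e, (q e).eval (edgeFlow f e) ≤ ∑ e, (q e).eval (edgeFlow g e)) ∧
      ∀ g, IsFeasible N g → ∑ e, (q e).derivative.eval (edgeFlow f e) * edgeFlow f e ≤
        ∑ e, (q e).derivative.eval (edgeFlow f e) * edgeFlow g e := by
  have hcont : Continuous fun f : K → E → ℝ => ∑ e, (q e).eval (edgeFlow f e) := by
    refine continuous_finsetSum _ fun e _ => (q e).continuous.comp ?_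
    unfold edgeFlow
    fun_prop
  obtain ⟨f, hf, hmin⟩ := (isCompact_setOf_isFeasible N).exists_isMinOn (exists_isFeasible N)
    hcont.continuousOn
  refine ⟨f, hf, fun g hg => hmin hg, fun g hg => ?_⟩
  -- `D` is the derivative of the objective at `f` in the direction of `g`; a negative value would
  -- contradict minimality.
  set D := ∑ e, (q e).derivative.eval (edgeFlow f e) * (edgeFlow g e - edgeFlow f e)
  have hflow : ∀ (a : ℝ) e, edgeFlow (f + a • (g - f)) e =
      edgeFlow f e + a * (edgeFlow g e - edgeFlow f e) := fun a e => by
    simp [edgeFlow, Finset.sum_add_distrib, Finset.mul_sum, mul_sub]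
  have hderiv : HasDerivAt (fun a : ℝ => ∑ e, (q e).eval (edgeFlow (f + a • (g - f)) e)) D 0 := by
    simp only [hflow]
    refine HasDerivAt.fun_sum fun e _ => ?_
    have h₁ : HasDerivAt (fun a : ℝ => edgeFlow f e + a * (edgeFlow g e - edgeFlow f e))
        (edgeFlow g e - edgeFlow f e) 0 := by
      simpa using ((hasDerivAt_id (0 : ℝ)).mul_const (edgeFlow g e - edgeFlow f e)).const_add
        (edgeFlow f e)
    have h₂ := (q e).hasDerivAt (edgeFlow f e + 0 * (edgeFlow g e - edgeFlow f e))
    simpa [Function.comp_def] using h₂.comp (0 : ℝ) h₁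
  have hD : 0 ≤ D := by
    by_contra! hneg
    obtain ⟨a, ha, hlt⟩ : ∃ a ∈ Set.Ioo (0 : ℝ) 1,
        ∑ e, (q e).eval (edgeFlow (f + a • (g - f)) e) <
          ∑ e, (q e).eval (edgeFlow (f + (0 : ℝ) • (g - f)) e) := by
      have h₁ := (hasDerivAt_iff_tendsto_slope_zero.1 hderiv).eventually (gt_mem_nhds hneg)
      have h₂ := h₁.filter_mono (nhdsGT_le_nhdsNE (0 : ℝ))
      obtain ⟨a, h, ha⟩ := (h₂.and (Ioo_mem_nhdsGT one_pos)).exists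
      refine ⟨a, ha, ?_⟩
      simp only [zero_add, smul_eq_mul] at h
      have := neg_of_mul_neg_right h (inv_nonneg.2 ha.1.le)
      linarith
    have := hmin (hf.add_smul_sub hg ⟨ha.1.le, ha.2.le⟩)
    simp only [zero_smul, add_zero] at hlt
    exact absurd hlt (not_lt.2 this)
  simp only [D, mul_sub, Finset.sum_sub_distrib] at hD
  linarith

end Feasible

/-! ### Estimates for standard polynomials -/

section Polynomials

open Polynomial

theorem exists_derivative_eq (p : ℝ[X]) : ∃ q : ℝ[X], derivative q = p := by
  induction p using Polynomial.induction_on' with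
  | add p₁ p₂ h₁ h₂ =>
    obtain ⟨q₁, rfl⟩ := h₁
    obtain ⟨q₂, rfl⟩ := h₂
    exact ⟨q₁ + q₂, by simp⟩
  | monomial n a =>
    refine ⟨monomial (n + 1) (a / (n + 1)), ?_⟩
    have : (n : ℝ) + 1 ≠ 0 := by positivity
    rw [derivative_monomial]
    simp [div_mul_cancel₀ a this]

variable {r : ℕ} {U : ℝ} {p : ℝ[X]}

theorem IsStandard.mono {U' : ℝ} (hU : 0 < U) (hUU : U ≤ U') (h : IsStandard r U p) :
    IsStandard r U' p := by
  obtain ⟨h₁, h₂, j, hj, hjU⟩ := h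
  exact ⟨h₁, fun i => ⟨(h₂ i).1, (h₂ i).2.trans hUU⟩, j, hj,
    (one_div_le_one_div_of_le hU hUU).trans hjU⟩

theorem IsStandard.eval_eq (h : IsStandard r U p) (x : ℝ) :
    p.eval x = ∑ i ∈ Finset.range (r + 1), p.coeff i * x ^ i :=
  eval_eq_sum_range' (Nat.lt_succ_of_le h.1) x

theorem IsStandard.eval_nonneg (h : IsStandard r U p) {x : ℝ} (hx : 0 ≤ x) : 0 ≤ p.eval x := by
  rw [h.eval_eq]
  exact Finset.sum_nonneg fun i _ => mul_nonneg (h.2.1 i).1 (pow_nonneg hx i)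

theorem IsStandard.eval_le (hU : 0 < U) (h : IsStandard r U p) {x B : ℝ} (hB : 1 ≤ B) (hx : 0 ≤ x)
    (hxB : x ≤ B) : p.eval x ≤ (r + 1) * (U * B ^ r) := by
  rw [h.eval_eq]
  have : ∀ i ∈ Finset.range (r + 1), p.coeff i * x ^ i ≤ U * B ^ r := fun i hi => by
    have := (h.2.1 i).2
    have h2 : x ^ i ≤ B ^ r := (pow_le_pow_left₀ hx hxB i).trans
      (pow_le_pow_right₀ hB (Nat.lt_succ_iff.1 (Finset.mem_range.1 hi)))
    gcongr
  simpa using Finset.sum_le_card_nsmul _ _ _ this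

/-- Standard polynomials are monotone, at a rate given by a power function. -/
theorem IsStandard.exists_pow_le (hU : 0 < U) (h : IsStandard r U p) :
    ∃ j ≤ r, ∀ x y : ℝ, 0 ≤ x → 0 ≤ y →
      |x - y| ^ (j + 1) / U ≤ (p.eval x - p.eval y) * (x - y) := by
  obtain ⟨j, hj, hjU⟩ := h.2.2
  have hjr : j ≤ r := (le_natDegree_of_ne_zero
    (ne_of_gt ((one_div_pos.2 hU).trans_le hjU))).trans h.1
  have key : ∀ x y : ℝ, 0 ≤ y → y ≤ x → (x - y) ^ j / U ≤ p.eval x - p.eval y := by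
    intro x y hy hyx
    rw [h.eval_eq, h.eval_eq, ← Finset.sum_sub_distrib]
    have hterm : ∀ i, 0 ≤ p.coeff i * x ^ i - p.coeff i * y ^ i := fun i => by
      rw [← mul_sub]
      exact mul_nonneg (h.2.1 i).1 (sub_nonneg.2 (pow_le_pow_left₀ hy hyx i))
    refine le_trans ?_ (Finset.single_le_sum (fun i _ => hterm i)
      (Finset.mem_range.2 (Nat.lt_succ_of_le hjr)))
    -- Superadditivity of the power: `y ^ j + (x - y) ^ j ≤ x ^ j`.
    have h₁ := pow_add_pow_le hy (sub_nonneg.2 hyx) (Nat.one_le_iff_ne_zero.1 hj)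
    rw [add_sub_cancel] at h₁
    rw [← mul_sub, div_eq_mul_one_div, mul_comm]
    exact mul_le_mul hjU (by linarith) (pow_nonneg (sub_nonneg.2 hyx) j) (h.2.1 j).1
  refine ⟨j, hjr, fun x y hx hy => ?_⟩
  rcases le_total y x with hyx | hxy
  · rw [abs_of_nonneg (sub_nonneg.2 hyx), pow_succ, mul_div_right_comm]
    exact mul_le_mul_of_nonneg_right (key x y hy hyx) (sub_nonneg.2 hyx)
  · rw [abs_of_nonpos (sub_nonpos.2 hxy), neg_sub, pow_succ, mul_div_right_comm]
    refine (mul_le_mul_of_nonneg_right (key y x hx hxy) (sub_nonneg.2 hxy)).trans_eq ?_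
    ring

theorem IsStandard.mul_sub_nonneg (hU : 0 < U) (h : IsStandard r U p) {x y : ℝ} (hx : 0 ≤ x)
    (hy : 0 ≤ y) : 0 ≤ (p.eval x - p.eval y) * (x - y) := by
  obtain ⟨j, -, hj⟩ := h.exists_pow_le hU
  exact le_trans (by positivity) (hj x y hx hy)

theorem IsStandard.mul_sub_ge (hU : 0 < U) (h : IsStandard r U p) {x y δ : ℝ} (hx : 0 ≤ x)
    (hy : 0 ≤ y) (hδ : 0 < δ) (hδ1 : δ ≤ 1) (hxy : δ ≤ |x - y|) :
    δ ^ (r + 1) / U ≤ (p.eval x - p.eval y) * (x - y) := by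
  obtain ⟨j, hjr, hj⟩ := h.exists_pow_le hU
  refine le_trans ?_ (hj x y hx hy)
  have : δ ^ (r + 1) ≤ |x - y| ^ (j + 1) :=
    (pow_le_pow_of_le_one hδ.le hδ1 (by omega)).trans (pow_le_pow_left₀ hδ.le hxy _)
  gcongr

theorem IsStandard.abs_mul_eval_sub_le (hU : 0 < U) (h : IsStandard r U p) {x y B : ℝ} (hB : 1 ≤ B)
    (hx : 0 ≤ x) (hxB : x ≤ B) (hy : 0 ≤ y) (hyB : y ≤ B) :
    |x * p.eval x - y * p.eval y| ≤ (r + 1) * (U * ((r + 1) * B ^ r)) * |x - y| := by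
  have heq : x * p.eval x - y * p.eval y =
      ∑ i ∈ Finset.range (r + 1), p.coeff i * (x ^ (i + 1) - y ^ (i + 1)) := by
    rw [h.eval_eq, h.eval_eq, Finset.mul_sum, Finset.mul_sum, ← Finset.sum_sub_distrib]
    exact Finset.sum_congr rfl fun i _ => by ring
  have hterm : ∀ i ∈ Finset.range (r + 1), |p.coeff i * (x ^ (i + 1) - y ^ (i + 1))| ≤
      U * ((r + 1) * B ^ r) * |x - y| := fun i hi => by
    have hir : i ≤ r := Nat.lt_succ_iff.1 (Finset.mem_range.1 hi)
    have h₁ := abs_pow_sub_pow_le x y (i + 1)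
    rw [abs_of_nonneg hx, abs_of_nonneg hy, Nat.add_sub_cancel] at h₁
    have h₂ : max x y ^ i ≤ B ^ r := (pow_le_pow_left₀ (le_max_of_le_left hx)
      (max_le hxB hyB) i).trans (pow_le_pow_right₀ hB hir)
    have h₃ : ((i + 1 : ℕ) : ℝ) ≤ r + 1 := by push_cast; gcongr
    rw [abs_mul, abs_of_nonneg (h.2.1 i).1, mul_assoc]
    refine mul_le_mul (h.2.1 i).2 (h₁.trans ?_) (abs_nonneg _) hU.le
    calc |x - y| * ((i + 1 : ℕ) : ℝ) * max x y ^ i ≤ |x - y| * (r + 1) * B ^ r := by gcongr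
      _ = _ := by ring
  rw [heq]
  refine (Finset.abs_sum_le_sum_abs _ _).trans ((Finset.sum_le_card_nsmul _ _ _ hterm).trans_eq ?_)
  simp only [Finset.card_range, nsmul_eq_mul]
  push_cast
  ring

end Polynomials

/-! ### Existence, uniqueness and separation by tolls -/

section Equilibria

variable {V E K : Type} [Fintype V] [Fintype E] [Fintype K] {N : Network V E K}
  {r : ℕ} {U : ℝ} {l : E → ℝ[X]}

/-- The Beckmann potential, whose summands are antiderivatives of `l e + τ e`, has the equilibrium
inequality as its first-order condition. -/
theorem exists_isEquilibriumFlow (N : Network V E K) (hl : ∀ e, IsStandard r U (l e))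
    (τ : E → ℝ≥0) : ∃ x, IsEquilibriumFlow N l τ x := by
  choose q hq using fun e => exists_derivative_eq (l e + Polynomial.C (τ e : ℝ))
  obtain ⟨f, hf, -, hmin⟩ := exists_isFeasible_minimizer N q
  refine ⟨_, f, isEquilibrium_of_forall_sum_le hf (fun e => ?_) fun g hg => ?_, rfl⟩
  · exact add_nonneg ((hl e).eval_nonneg (hf.edgeFlow_mem_Icc e).1) (τ e).2
  · simpa [hq] using hmin g hg

/-- Adding the variational inequalities of both equilibria cancels the tolls and forces every
monotonicity term to vanish. -/
theorem IsEquilibriumFlow.unique (hU : 0 < U) (hl : ∀ e, IsStandard r U (l e)) {τ : E → ℝ≥0}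
    {x y : E → ℝ} (hx : IsEquilibriumFlow N l τ x) (hy : IsEquilibriumFlow N l τ y) : x = y := by
  obtain ⟨f, hf, rfl⟩ := hx
  obtain ⟨g, hg, rfl⟩ := hy
  have h₁ := hf.sum_le hg.1
  have h₂ := hg.sum_le hf.1
  have hterm : ∀ e, 0 ≤ ((l e).eval (edgeFlow f e) - (l e).eval (edgeFlow g e)) *
      (edgeFlow f e - edgeFlow g e) := fun e =>
    (hl e).mul_sub_nonneg hU (hf.1.edgeFlow_mem_Icc e).1 (hg.1.edgeFlow_mem_Icc e).1
  have hsum : ∑ e, ((l e).eval (edgeFlow f e) - (l e).eval (edgeFlow g e)) *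
      (edgeFlow f e - edgeFlow g e) = 0 := by
    refine le_antisymm ?_ (Finset.sum_nonneg fun e _ => hterm e)
    have h₃ := add_le_add h₁ h₂
    rw [← sub_nonpos, ← Finset.sum_add_distrib, ← Finset.sum_add_distrib,
      ← Finset.sum_sub_distrib] at h₃
    refine le_of_eq_of_le (Finset.sum_congr rfl fun e _ => ?_) h₃
    ring
  ext e
  have h0 := (Finset.sum_eq_zero_iff_of_nonneg fun e _ => hterm e).1 hsum e (Finset.mem_univ e)
  obtain ⟨j, -, hj⟩ := (hl e).exists_pow_le hU
  have h₄ := hj _ _ (hf.1.edgeFlow_mem_Icc e).1 (hg.1.edgeFlow_mem_Icc e).1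
  rw [h0] at h₄
  by_contra hne
  have : 0 < |edgeFlow f e - edgeFlow g e| := abs_pos.2 (sub_ne_zero.2 hne)
  exact absurd h₄ (not_le.2 (by positivity))

theorem isEquilibriumFlow_eqFlow (N : Network V E K) (hl : ∀ e, IsStandard r U (l e))
    (τ : E → ℝ≥0) : IsEquilibriumFlow N l τ (eqFlow N l τ) :=
  Classical.epsilon_spec (exists_isEquilibriumFlow N hl τ)

/-- `x` is an edge flow that minimizes a linear cost with all coefficients at least `η`. -/
def IsSupported (N : Network V E K) (η : ℝ) (x : E → ℝ) : Prop :=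
  (∃ f, IsFeasible N f ∧ edgeFlow f = x) ∧
    ∃ c : E → ℝ, (∀ e, η ≤ c e) ∧
      ∀ f, IsFeasible N f → ∑ e, c e * x e ≤ ∑ e, c e * edgeFlow f e

/-- If `x` minimizes the linear cost `c` and the equilibrium for the tolls `a * c - z` is not close
to `x`, then it yields a half-space that separates `z` from the latencies at `x`. -/
theorem pow_le_sum_of_toll (hU : 0 < U) (hl : ∀ e, IsStandard r U (l e)) {g : K → E → ℝ}
    (hg : IsFeasible N g) {c : E → ℝ}
    (hc : ∀ f, IsFeasible N f → ∑ e, c e * edgeFlow g e ≤ ∑ e, c e * edgeFlow f e)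
    {a : ℝ} (ha : 0 ≤ a) {z : E → ℝ} {τ : E → ℝ≥0} (hτ : ∀ e, (τ e : ℝ) = a * c e - z e)
    {δ : ℝ} (hδ : 0 < δ) (hδ1 : δ ≤ 1) {e₀ : E} (he₀ : δ < |eqFlow N l τ e₀ - edgeFlow g e₀|) :
    δ ^ (r + 1) / U ≤ ∑ e, (z e - (l e).eval (edgeFlow g e)) *
      (eqFlow N l τ e - edgeFlow g e) := by
  obtain ⟨f, hf, hfx⟩ := isEquilibriumFlow_eqFlow N hl τ
  rw [← hfx] at he₀ ⊢
  have h₁ := hf.sum_le hg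
  have h₂ := mul_le_mul_of_nonneg_left (hc f hf.1) ha
  have hterm : ∀ e, 0 ≤ ((l e).eval (edgeFlow f e) - (l e).eval (edgeFlow g e)) *
      (edgeFlow f e - edgeFlow g e) := fun e =>
    (hl e).mul_sub_nonneg hU (hf.1.edgeFlow_mem_Icc e).1 (hg.edgeFlow_mem_Icc e).1
  refine ((hl e₀).mul_sub_ge hU (hf.1.edgeFlow_mem_Icc e₀).1 (hg.edgeFlow_mem_Icc e₀).1 hδ hδ1
    he₀.le).trans ((Finset.single_le_sum (fun e _ => hterm e) (Finset.mem_univ e₀)).trans ?_)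
  simp only [hτ] at h₁
  rw [Finset.mul_sum, Finset.mul_sum] at h₂
  have h₃ := add_le_add h₁ h₂
  rw [← sub_nonneg, ← Finset.sum_add_distrib, ← Finset.sum_add_distrib,
    ← Finset.sum_sub_distrib] at h₃
  rw [← sub_nonneg, ← Finset.sum_sub_distrib]
  refine h₃.trans_eq (Finset.sum_congr rfl fun e _ => ?_)
  ring

theorem abs_cost_sub_le (hU : 0 < U) (hl : ∀ e, IsStandard r U (l e)) {B δ : ℝ} (hB : 1 ≤ B)
    {x y : E → ℝ} (hx : ∀ e, 0 ≤ x e ∧ x e ≤ B) (hy : ∀ e, 0 ≤ y e ∧ y e ≤ B)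
    (hxy : ∀ e, |x e - y e| ≤ δ) :
    |cost l x - cost l y| ≤ Fintype.card E * ((r + 1) * (U * ((r + 1) * B ^ r)) * δ) := by
  unfold cost
  rw [← Finset.sum_sub_distrib]
  refine (Finset.abs_sum_le_sum_abs _ _).trans ?_
  have h : ∀ e ∈ Finset.univ, |x e * (l e).eval (x e) - y e * (l e).eval (y e)| ≤
      (r + 1) * (U * ((r + 1) * B ^ r)) * δ := fun e _ =>
    ((hl e).abs_mul_eval_sub_le hU hB (hx e).1 (hx e).2 (hy e).1 (hy e).2).trans
      (mul_le_mul_of_nonneg_left (hxy e) (by positivity))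
  simpa using Finset.sum_le_card_nsmul _ _ _ h

/-- Some supported edge flow is nearly optimal. -/
theorem exists_isSupported_cost_le (N : Network V E K) (hl : ∀ e, IsStandard r U (l e)) {η B : ℝ}
    (hη : 0 ≤ η) (hB : ∑ i, N.demand i ≤ B) :
    ∃ x, IsSupported N η x ∧ ∀ f, IsFeasible N f →
      cost l x ≤ cost l (edgeFlow f) + Fintype.card E * (η * B) := by
  -- The supporting cost is the derivative of this objective, the marginal cost plus `η`.
  obtain ⟨f, hf, hmin, hfo⟩ := exists_isFeasible_minimizer N
    fun e => Polynomial.X * l e + Polynomial.C η * Polynomial.X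
  refine ⟨_, ⟨⟨f, hf, rfl⟩, _, fun e => ?_, hfo⟩, fun g hg => ?_⟩
  · have h₁ := (hf.edgeFlow_mem_Icc e).1
    have h₂ := (hl e).eval_nonneg h₁
    have h₃ : 0 ≤ (Polynomial.derivative (l e)).eval (edgeFlow f e) := by
      rw [Polynomial.eval_eq_sum_range]
      refine Finset.sum_nonneg fun i _ => mul_nonneg ?_ (pow_nonneg h₁ i)
      rw [Polynomial.coeff_derivative]
      exact mul_nonneg ((hl e).2.1 _).1 (by positivity)
    simp only [Polynomial.derivative_add, Polynomial.derivative_mul, Polynomial.derivative_X,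
      Polynomial.derivative_C, Polynomial.eval_add, Polynomial.eval_mul, Polynomial.eval_X,
      Polynomial.eval_C, one_mul, zero_mul, zero_add, mul_one]
    nlinarith [mul_nonneg h₁ h₃]
  · have h := hmin g hg
    simp only [Polynomial.eval_add, Polynomial.eval_mul, Polynomial.eval_X, Polynomial.eval_C,
      Finset.sum_add_distrib] at h
    have h₁ : 0 ≤ ∑ e, η * edgeFlow f e :=
      Finset.sum_nonneg fun e _ => mul_nonneg hη (hf.edgeFlow_mem_Icc e).1
    have h₂ : ∑ e, η * edgeFlow g e ≤ Fintype.card E * (η * B) := by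
      simpa using Finset.sum_le_card_nsmul Finset.univ (fun e => η * edgeFlow g e) (η * B)
        fun e _ => mul_le_mul_of_nonneg_left ((hg.edgeFlow_mem_Icc e).2.trans hB) hη
    unfold cost
    linarith

end Equilibria

/-! ### Query algorithms: enforcing targets and learning costs -/

section Search

variable {V E K : Type} [Fintype E] [Fintype K] {N : Network V E K}

/-- A Bernoulli-type bound: `m + 1` cuts by the factor `m / (m + 1)` at least halve the candidates.
-/
theorem two_mul_pow_succ_le (m : ℕ) : 2 * m ^ (m + 1) ≤ (m + 1) ^ (m + 1) := by
  have h : ∀ n : ℕ, m ^ (n + 1) + (n + 1) * m ^ n ≤ (m + 1) ^ (n + 1) := by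
    intro n
    induction n with
    | zero => simp
    | succ n ih =>
      calc m ^ (n + 1 + 1) + (n + 1 + 1) * m ^ (n + 1)
          ≤ m ^ (n + 1 + 1) + (n + 1 + 1) * m ^ (n + 1) + (n + 1) * m ^ n := Nat.le_add_right _ _
        _ = (m + 1) * (m ^ (n + 1) + (n + 1) * m ^ n) := by ring
        _ ≤ (m + 1) * (m + 1) ^ (n + 1) := Nat.mul_le_mul_left _ ih
        _ = _ := by ring
  calc 2 * m ^ (m + 1) = m ^ (m + 1) + m * m ^ m := by ring
    _ ≤ m ^ (m + 1) + (m + 1) * m ^ m := by gcongr; omega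
    _ ≤ _ := h m

theorem pow_mul_lt_pow {m w q : ℕ} (hq : q ≤ 2 ^ w) :
    m ^ ((m + 1) * (w + 1)) * q < (m + 1) ^ ((m + 1) * (w + 1)) := by
  have h := Nat.pow_le_pow_left (two_mul_pow_succ_le m) (w + 1)
  rw [mul_pow, ← pow_mul, ← pow_mul] at h
  have hq' : q < 2 ^ (w + 1) := hq.trans_lt (Nat.pow_lt_pow_right one_lt_two (Nat.lt_succ_self w))
  rcases Nat.eq_zero_or_pos (m ^ ((m + 1) * (w + 1))) with h0 | h0
  · rw [h0, zero_mul]; positivity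
  · calc _ < m ^ ((m + 1) * (w + 1)) * 2 ^ (w + 1) := Nat.mul_lt_mul_of_pos_left hq' h0
      _ ≤ _ := by rwa [mul_comm]

/-- Grids of spacing `2⁻ˢ` in the box `[0, 2ᵃ]ᴱ`. -/
theorem exists_grid (E : Type) [Fintype E] (a s : ℕ) :
    ∃ P : Finset (E → ℝ), P.card ≤ 2 ^ ((a + s + 1) * Fintype.card E) ∧
      (∀ p ∈ P, ∀ e, p e ≤ 2 ^ a) ∧
      ∀ v : E → ℝ, (∀ e, 0 ≤ v e ∧ v e ≤ 2 ^ a) → ∃ p ∈ P, ∀ e, |p e - v e| ≤ 1 / 2 ^ s := by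
  classical
  let Q : Finset ℝ := (Finset.range (2 ^ (a + s) + 1)).image fun j : ℕ => (j : ℝ) / 2 ^ s
  have hQ : Q.card ≤ 2 ^ (a + s + 1) := by
    refine Finset.card_image_le.trans ?_
    rw [Finset.card_range, pow_succ]
    have := Nat.one_le_two_pow (n := a + s)
    omega
  refine ⟨Fintype.piFinset fun _ => Q, ?_, fun p hp e => ?_, fun v hv => ?_⟩
  · rw [Fintype.card_piFinset, Finset.prod_const, Finset.card_univ, pow_mul]
    exact Nat.pow_le_pow_left hQ _
  · obtain ⟨j, hj, hjp⟩ := Finset.mem_image.1 (Fintype.mem_piFinset.1 hp e)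
    rw [← hjp, div_le_iff₀ (by positivity), ← pow_add]
    exact_mod_cast Nat.lt_succ_iff.1 (Finset.mem_range.1 hj)
  · refine ⟨fun e => (⌊v e * 2 ^ s⌋₊ : ℝ) / 2 ^ s, Fintype.mem_piFinset.2 fun e =>
      Finset.mem_image_of_mem (fun j : ℕ => (j : ℝ) / 2 ^ s)
        (Finset.mem_range.2 (Nat.lt_succ_of_le ?_)), fun e => ?_⟩
    · refine Nat.floor_le_of_le ?_
      push_cast
      rw [pow_add]
      exact mul_le_mul_of_nonneg_right (hv e).2 (by positivity)
    · have h2 : (0 : ℝ) < 2 ^ s := by positivity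
      have h₀ : 0 ≤ v e * 2 ^ s := mul_nonneg (hv e).1 h2.le
      have h₁ := Nat.floor_le h₀
      have h₃ := Nat.lt_floor_add_one (v e * 2 ^ s)
      have : (⌊v e * 2 ^ s⌋₊ : ℝ) / 2 ^ s - v e = (⌊v e * 2 ^ s⌋₊ - v e * 2 ^ s) / 2 ^ s := by
        field_simp
      rw [this, abs_div, abs_of_pos h2]
      refine div_le_div_of_nonneg_right ?_ h2.le
      rw [abs_le]
      constructor <;> linarith

/-- Binary search for tolls that nearly enforce a supported edge flow `x`. The candidates `P` for
the vector of latencies at `x` are cut down by half-spaces through centerpoints. The tolls that were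
found are handed over to the continuation `k`, together with the total latency. -/
theorem exists_algorithm_search [Fintype V] {r : ℕ} {U η B δ ρ L : ℝ} (hU : 0 < U) (hη : 0 < η)
    (hB : ∑ i, N.demand i ≤ B) (hδ : 0 < δ) (hδ1 : δ ≤ 1) (hL : 0 ≤ L)
    (hρ : Fintype.card E * (ρ * B) < δ ^ (r + 1) / U) {x : E → ℝ} (hx : IsSupported N η x)
    (k : (E → ℝ≥0) → ℝ → Algorithm E) (T : ℕ) (P : Finset (E → ℝ)) (hP : ∀ p ∈ P, ∀ e, p e ≤ L)
    (hcard : Fintype.card E ^ T * P.card < (Fintype.card E + 1) ^ T) :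
    ∃ A : Algorithm E, ∀ l : E → ℝ[X], (∀ e, IsStandard r U (l e)) →
      (∃ p ∈ P, ∀ e, |p e - (l e).eval (x e)| ≤ ρ) →
      ∃ τ, (∀ e, |eqFlow N l τ e - x e| ≤ δ) ∧
        A.result (oracle N l) = (k τ (cost l (eqFlow N l τ))).result (oracle N l) ∧
        A.numQueries (oracle N l) ≤
          T + (k τ (cost l (eqFlow N l τ))).numQueries (oracle N l) := by
  classical
  obtain ⟨⟨g, hg, rfl⟩, c, hcη, hc⟩ := hx
  induction T generalizing P with
  | zero =>
    -- With no rounds left, `hcard` says that `P` is empty, so the output is irrelevant.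
    refine ⟨.output 0, fun l _ ⟨p, hp, _⟩ => ?_⟩
    have : 0 < P.card := Finset.card_pos.2 ⟨p, hp⟩
    simp only [pow_zero, one_mul] at hcard
    omega
  | succ T ih =>
    rcases P.eq_empty_or_nonempty with rfl | hne
    · exact ⟨.output 0, fun l _ ⟨p, hp, _⟩ => by simp at hp⟩
    obtain ⟨z, hz, hcut⟩ := exists_centerpoint hne
    have hzL : ∀ e, z e ≤ L := by
      have hconv : Convex ℝ (Set.Iic fun _ : E => L) := convex_Iic _
      exact convexHull_min (fun p hp => hP p hp) hconv hz
    -- Since `c ≥ η` and `z ≤ L`, the factor `L / η` makes `toNNReal` truncate nothing.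
    set τ : E → ℝ≥0 := fun e => (L / η * c e - z e).toNNReal with hτ_def
    have hτ : ∀ e, (τ e : ℝ) = L / η * c e - z e := fun e => by
      refine Real.coe_toNNReal _ ?_
      have : L ≤ L / η * c e := by
        calc L = L / η * η := by field_simp
          _ ≤ _ := mul_le_mul_of_nonneg_left (hcη e) (by positivity)
      linarith [hzL e]
    set P' : (E → ℝ) → Finset (E → ℝ) := fun f =>
      P.filter fun p => 0 < ∑ e, (z e - p e) * (f e - edgeFlow g e) with hP'
    have hnext : ∀ f, Fintype.card E ^ T * (P' f).card < (Fintype.card E + 1) ^ T := fun f => by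
      have h₁ := hcut fun e => f e - edgeFlow g e
      have h₂ : (Fintype.card E + 1) * (Fintype.card E ^ T * (P' f).card) <
          (Fintype.card E + 1) * (Fintype.card E + 1) ^ T := calc
        _ = Fintype.card E ^ T * ((Fintype.card E + 1) * (P' f).card) := by ring
        _ ≤ Fintype.card E ^ T * (Fintype.card E * P.card) := Nat.mul_le_mul_left _ h₁
        _ = Fintype.card E ^ (T + 1) * P.card := by ring
        _ < _ := hcard
        _ = _ := by ring
      exact Nat.lt_of_mul_lt_mul_left h₂
    -- The algorithm may not depend on `l`, so a continuation is fixed for every conceivable answer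
    -- `f`.
    choose A hA using fun f => ih (P' f)
      (fun p hp => hP p (Finset.mem_filter.1 hp).1) (hnext f)
    refine ⟨.query τ fun f v => if ∀ e, |f e - edgeFlow g e| ≤ δ then k τ v else A f,
      fun l hl ⟨p, hp, hpl⟩ => ?_⟩
    by_cases hclose : ∀ e, |eqFlow N l τ e - edgeFlow g e| ≤ δ
    · refine ⟨τ, hclose, ?_, ?_⟩
      · simp [Algorithm.result, oracle, hclose]
      · simp only [Algorithm.numQueries, oracle, hclose, implies_true, if_true]
        omega
    -- The candidate near the true latencies survives: rounding changes the separating sum by at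
    -- most `m * (ρ * B)`, which `hρ` keeps below the margin.
    · have hmem : p ∈ P' (eqFlow N l τ) := by
        refine Finset.mem_filter.2 ⟨hp, ?_⟩
        obtain ⟨e₀, he₀⟩ := not_forall.1 hclose
        have h₁ := pow_le_sum_of_toll hU hl hg hc (div_nonneg hL hη.le) hτ hδ hδ1 (not_le.1 he₀)
        obtain ⟨f, hf, hfx⟩ := isEquilibriumFlow_eqFlow N hl τ
        have h₂ : ∀ e ∈ Finset.univ, (p e - (l e).eval (edgeFlow g e)) *
            (eqFlow N l τ e - edgeFlow g e) ≤ ρ * B := fun e _ => by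
          have h₃ : |eqFlow N l τ e - edgeFlow g e| ≤ B := by
            rw [← hfx, abs_le]
            have := hf.1.edgeFlow_mem_Icc e
            have := hg.edgeFlow_mem_Icc e
            constructor <;> linarith
          refine (le_abs_self _).trans ?_
          rw [abs_mul]
          exact mul_le_mul (hpl e) h₃ (abs_nonneg _) ((abs_nonneg _).trans (hpl e))
        have h₄ := Finset.sum_le_card_nsmul _ _ _ h₂
        rw [nsmul_eq_mul, Finset.card_univ] at h₄
        have h₅ : ∑ e, (z e - p e) * (eqFlow N l τ e - edgeFlow g e) =
            ∑ e, (z e - (l e).eval (edgeFlow g e)) * (eqFlow N l τ e - edgeFlow g e) -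
            ∑ e, (p e - (l e).eval (edgeFlow g e)) * (eqFlow N l τ e - edgeFlow g e) := by
          rw [← Finset.sum_sub_distrib]
          exact Finset.sum_congr rfl fun e _ => by ring
        rw [h₅]
        linarith
      obtain ⟨τ', h₁, h₂, h₃⟩ := hA (eqFlow N l τ) l hl ⟨p, hmem, hpl⟩
      refine ⟨τ', h₁, ?_, ?_⟩
      · simp only [Algorithm.result, oracle, hclose, if_false]
        exact h₂
      · simp only [Algorithm.numQueries, oracle, hclose, if_false]
        exact (Nat.succ_le_succ h₃).trans_eq (by omega)

theorem exists_algorithm_enforce [Fintype V] {r a s : ℕ} {U η B δ : ℝ} (hU : 0 < U) (hη : 0 < η)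
    (hB1 : 1 ≤ B) (hB : ∑ i, N.demand i ≤ B) (hδ : 0 < δ) (hδ1 : δ ≤ 1)
    (ha : (r + 1) * (U * B ^ r) ≤ 2 ^ a)
    (hs : Fintype.card E * (1 / 2 ^ s * B) < δ ^ (r + 1) / U) {x : E → ℝ} (hx : IsSupported N η x)
    (k : (E → ℝ≥0) → ℝ → Algorithm E) :
    ∃ A : Algorithm E, ∀ l : E → ℝ[X], (∀ e, IsStandard r U (l e)) →
      ∃ τ, (∀ e, |eqFlow N l τ e - x e| ≤ δ) ∧
        A.result (oracle N l) = (k τ (cost l (eqFlow N l τ))).result (oracle N l) ∧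
        A.numQueries (oracle N l) ≤
          (Fintype.card E + 1) * ((a + s + 1) * Fintype.card E + 1) +
            (k τ (cost l (eqFlow N l τ))).numQueries (oracle N l) := by
  obtain ⟨P, hcard, hPL, hgrid⟩ := exists_grid E a s
  obtain ⟨A, hA⟩ := exists_algorithm_search hU hη hB hδ hδ1 (by positivity) hs hx k _ P hPL
    (pow_mul_lt_pow hcard)
  refine ⟨A, fun l hl => hA l hl (hgrid _ fun e => ?_)⟩
  obtain ⟨⟨f, hf, rfl⟩, -⟩ := hx
  have h := hf.edgeFlow_mem_Icc e
  exact ⟨(hl e).eval_nonneg h.1, ((hl e).eval_le hU hB1 h.1 (h.2.trans hB)).trans ha⟩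

/-- If single targets can be enforced with `T` queries, then the total latencies near `n` targets
can be found with `n * T` queries. -/
theorem exists_algorithm_learn {C : (E → ℝ[X]) → Prop} {S : (E → ℝ) → Prop} {δ : ℝ} {T : ℕ}
    (h : ∀ x, S x → ∀ k : (E → ℝ≥0) → ℝ → Algorithm E,
      ∃ A : Algorithm E, ∀ l, C l → ∃ τ, (∀ e, |eqFlow N l τ e - x e| ≤ δ) ∧
        A.result (oracle N l) = (k τ (cost l (eqFlow N l τ))).result (oracle N l) ∧
        A.numQueries (oracle N l) ≤
          T + (k τ (cost l (eqFlow N l τ))).numQueries (oracle N l))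
    {n : ℕ} (y : Fin n → E → ℝ) (hy : ∀ j, S (y j)) (k : (Fin n → ℝ) → Algorithm E) :
    ∃ A : Algorithm E, ∀ l, C l → ∃ v : Fin n → ℝ,
      (∀ j, ∃ τ, (∀ e, |eqFlow N l τ e - y j e| ≤ δ) ∧ v j = cost l (eqFlow N l τ)) ∧
        A.result (oracle N l) = (k v).result (oracle N l) ∧
        A.numQueries (oracle N l) ≤ n * T + (k v).numQueries (oracle N l) := by
  induction n with
  | zero => exact ⟨k 0, fun l _ => ⟨0, fun j => j.elim0, rfl, by simp⟩⟩
  | succ n ih =>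
    choose A hA using fun t : ℝ => ih (fun j => y j.succ) (fun j => hy j.succ)
      (fun v => k (Fin.cons t v))
    obtain ⟨A₀, hA₀⟩ := h (y 0) (hy 0) fun _ t => A t
    refine ⟨A₀, fun l hl => ?_⟩
    obtain ⟨τ, hτ, hres, hnum⟩ := hA₀ l hl
    obtain ⟨v, hv, hres', hnum'⟩ := hA (cost l (eqFlow N l τ)) l hl
    refine ⟨Fin.cons (cost l (eqFlow N l τ)) v, Fin.cases ⟨τ, hτ, rfl⟩ fun j => hv j,
      hres.trans hres', hnum.trans ?_⟩
    rw [Nat.succ_mul]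
    omega

end Search

/-! ### Optimization over supported flows and the choice of parameters -/

section Main

variable {V E K : Type} [Fintype V] [Fintype E] [Fintype K]

/-- The spanner coefficients come without continuity, so the estimated cost may have no minimizer;
near-minimizers suffice. -/
theorem exists_forall_le_add {X : Type} [Nonempty X] {F : X → ℝ} {M γ : ℝ} (hM : ∀ x, M ≤ F x)
    (hγ : 0 < γ) : ∃ x, ∀ y, F x ≤ F y + γ := by
  have hbdd : BddBelow (Set.range F) := ⟨M, by rintro _ ⟨x, rfl⟩; exact hM x⟩
  obtain ⟨_, ⟨x, rfl⟩, hx⟩ := exists_lt_of_csInf_lt (Set.range_nonempty F)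
    (lt_add_of_pos_right (sInf (Set.range F)) hγ)
  exact ⟨x, fun y => hx.le.trans (by gcongr; exact csInf_le hbdd ⟨y, rfl⟩)⟩

/-- The powers of the edge flows on which the total latency depends linearly. -/
def flowPowers (r : ℕ) (x : E → ℝ) (q : E × Fin (r + 1)) : ℝ := x q.1 ^ ((q.2 : ℕ) + 1)

theorem cost_eq_sum_flowPowers {r : ℕ} {U : ℝ} {l : E → ℝ[X]} (hl : ∀ e, IsStandard r U (l e))
    (x : E → ℝ) : cost l x = ∑ q : E × Fin (r + 1), (l q.1).coeff q.2 * flowPowers r x q := by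
  rw [Fintype.sum_prod_type]
  refine Finset.sum_congr rfl fun e _ => ?_
  rw [(hl e).eval_eq, Finset.mul_sum, ← Fin.sum_univ_eq_sum_range
    (fun i => x e * ((l e).coeff i * x e ^ i))]
  refine Finset.sum_congr rfl fun j _ => ?_
  simp only [flowPowers]
  ring

theorem IsSupported.mem_Icc {N : Network V E K} {η B : ℝ} {x : E → ℝ} (hx : IsSupported N η x)
    (hB : ∑ i, N.demand i ≤ B) (e : E) : 0 ≤ x e ∧ x e ≤ B := by
  obtain ⟨⟨f, hf, rfl⟩, -⟩ := hx
  exact ⟨(hf.edgeFlow_mem_Icc e).1, (hf.edgeFlow_mem_Icc e).2.trans hB⟩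

/-- If supported edge flows can be enforced up to `δ` with `T` queries, then a nearly optimal
flow can be enforced by learning the total latency function from enforced flows. -/
theorem exists_algorithm_optimize (N : Network V E K) {r T : ℕ} {U η B δ Λ γ : ℝ}
    (hU : 0 < U) (hη : 0 ≤ η) (hB1 : 1 ≤ B) (hB : ∑ i, N.demand i ≤ B) (hδ : 0 ≤ δ) (hγ : 0 < γ)
    (hΛ : Fintype.card E * ((r + 1) * (U * ((r + 1) * B ^ r)) * δ) ≤ Λ)
    (h : ∀ x, IsSupported N η x → ∀ k : (E → ℝ≥0) → ℝ → Algorithm E,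
      ∃ A : Algorithm E, ∀ l : E → ℝ[X], (∀ e, IsStandard r U (l e)) →
        ∃ τ, (∀ e, |eqFlow N l τ e - x e| ≤ δ) ∧
        A.result (oracle N l) = (k τ (cost l (eqFlow N l τ))).result (oracle N l) ∧
        A.numQueries (oracle N l) ≤
          T + (k τ (cost l (eqFlow N l τ))).numQueries (oracle N l)) :
    ∃ A : Algorithm E, ∀ l : E → ℝ[X], (∀ e, IsStandard r U (l e)) →
      A.numQueries (oracle N l) ≤ (Fintype.card E * (r + 1) + 1) * T ∧
      ∀ f, IsFeasible N f → cost l (eqFlow N l (A.result (oracle N l))) ≤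
        cost l (edgeFlow f) + (Fintype.card E * (η * B) + γ +
          (4 * (Fintype.card E * (r + 1)) + 1) * Λ) := by
  have hbound : ∀ x : {x // IsSupported N η x}, ‖flowPowers r x.1‖ ≤ B ^ (r + 1) := fun x => by
    refine (pi_norm_le_iff_of_nonneg (by positivity)).2 fun q => ?_
    obtain ⟨h₀, h₁⟩ := x.2.mem_Icc hB q.1
    rw [flowPowers, Real.norm_of_nonneg (pow_nonneg h₀ _)]
    exact (pow_le_pow_left₀ h₀ h₁ _).trans (pow_le_pow_right₀ hB1 q.2.2)
  obtain ⟨n, hn, y, hy⟩ := exists_spanner (fun x : {x // IsSupported N η x} => flowPowers r x.1)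
    hbound
  choose c hc2 hc using hy
  have hn' : n ≤ Fintype.card E * (r + 1) := by simpa using hn
  have : Nonempty {x // IsSupported N η x} := by
    obtain ⟨f, hf, -, hmin⟩ := exists_isFeasible_minimizer N
      fun _ => Polynomial.C η * Polynomial.X
    exact ⟨_, ⟨f, hf, rfl⟩, _, fun e => by simp, hmin⟩
  have hmin : ∀ v : Fin n → ℝ, ∃ x : {x // IsSupported N η x},
      ∀ y, ∑ j, c x j * v j ≤ ∑ j, c y j * v j + γ := fun v => by
    refine exists_forall_le_add (M := ∑ j, -(2 * |v j|)) (fun x => ?_) hγ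
    refine Finset.sum_le_sum fun j _ => ?_
    refine le_trans (neg_le_neg ?_) (neg_abs_le _)
    rw [abs_mul]
    exact mul_le_mul_of_nonneg_right (hc2 x j) (abs_nonneg _)
  choose best hbest using hmin
  choose A hA using fun v => h (best v).1 (best v).2 fun τ _ => .output τ
  -- Learn the costs near the spanner flows `y`, then use one more enforcement for the flow that
  -- looks best.
  obtain ⟨A₀, hA₀⟩ := exists_algorithm_learn h (fun j => (y j).1) (fun j => (y j).2) A
  refine ⟨A₀, fun l hl => ?_⟩
  obtain ⟨v, hv, hres, hnum⟩ := hA₀ l hl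
  obtain ⟨τ, hτ, hres', hnum'⟩ := hA v l hl
  have hclose : ∀ (x : {x // IsSupported N η x}) (σ : E → ℝ≥0),
      (∀ e, |eqFlow N l σ e - x.1 e| ≤ δ) → |cost l (eqFlow N l σ) - cost l x.1| ≤ Λ := by
    intro x σ hσ
    obtain ⟨f, hf, hfx⟩ := isEquilibriumFlow_eqFlow N hl σ
    refine (abs_cost_sub_le hU hl hB1 (fun e => ?_) (x.2.mem_Icc hB) hσ).trans hΛ
    rw [← hfx]
    exact ⟨(hf.1.edgeFlow_mem_Icc e).1, (hf.1.edgeFlow_mem_Icc e).2.trans hB⟩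
  have hΛ0 : 0 ≤ Λ := le_trans (by positivity) hΛ
  have hest : ∀ x : {x // IsSupported N η x},
      |∑ j, c x j * v j - cost l x.1| ≤ 2 * (Fintype.card E * (r + 1)) * Λ := fun x => by
    have hlin : cost l x.1 = ∑ j, c x j * cost l (y j).1 := by
      simp only [cost_eq_sum_flowPowers hl, hc x, Finset.sum_apply, Pi.smul_apply, smul_eq_mul,
        Finset.mul_sum]
      rw [Finset.sum_comm]
      exact Finset.sum_congr rfl fun j _ => Finset.sum_congr rfl fun q _ => by ring
    rw [hlin, ← Finset.sum_sub_distrib]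
    have hterm : ∀ j ∈ Finset.univ, |c x j * v j - c x j * cost l (y j).1| ≤ 2 * Λ := by
      intro j _
      obtain ⟨σ, hσ, hvσ⟩ := hv j
      rw [← mul_sub, abs_mul, hvσ]
      exact mul_le_mul (hc2 x j) (hclose (y j) σ hσ) (abs_nonneg _) two_pos.le
    refine (Finset.abs_sum_le_sum_abs _ _).trans ((Finset.sum_le_card_nsmul _ _ _ hterm).trans ?_)
    rw [Finset.card_univ, Fintype.card_fin, nsmul_eq_mul]
    have : (n : ℝ) ≤ Fintype.card E * (r + 1) := by exact_mod_cast hn'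
    calc (n : ℝ) * (2 * Λ) ≤ Fintype.card E * (r + 1) * (2 * Λ) := by gcongr
      _ = _ := by ring
  refine ⟨?_, fun f hf => ?_⟩
  · have h₁ := Nat.mul_le_mul_right T hn'
    simp only [Algorithm.numQueries] at hnum'
    rw [add_mul, one_mul]
    omega
  · rw [hres, hres']
    simp only [Algorithm.result]
    -- The errors add up: `Λ` for enforcing, `2 * (m * (r + 1)) * Λ` for each of two estimates, `γ`
    -- for near-minimality, and `m * (η * B)` for restricting to supported flows.
    obtain ⟨x, hx, hxopt⟩ := exists_isSupported_cost_le N hl hη hB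
    have h₁ := (abs_le.1 (hclose (best v) τ hτ)).2
    have h₂ := (abs_le.1 (hest (best v))).1
    have h₃ := (abs_le.1 (hest ⟨x, hx⟩)).2
    have h₄ := hbest v ⟨x, hx⟩
    have h₅ := hxopt f hf
    dsimp only at h₃
    linarith

/-- A bound for the number of queries in terms of the number `m` of edges, the degree `r`, and the
binary lengths `b`, `u`, `t` of the total demand, the coefficients and the inverse accuracy. -/
def queryBound {R : Type} [Semiring R] (m r b u t : R) : R :=
  (m * (r + 1) + 1) * ((m + 1) * ((r + u + b * r +
    (m + b + (t + 4 + m + r + (m + r + r + u + b * r)) * (r + 1) + u) + 1) * m + 1))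

theorem exists_algorithm_queryBound (N : Network V E K) (r b u t : ℕ)
    (hb : ∑ i, N.demand i ≤ 2 ^ b) :
    ∃ A : Algorithm E, ∀ l : E → ℝ[X], (∀ e, IsStandard r (2 ^ u) (l e)) →
      A.numQueries (oracle N l) ≤ queryBound (Fintype.card E) r b u t ∧
      ∀ f, IsFeasible N f → cost l (eqFlow N l (A.result (oracle N l))) ≤
        cost l (edgeFlow f) + 1 / 2 ^ t := by
  set m := Fintype.card E with hm_def
  have hm : (m : ℝ) ≤ 2 ^ m := by exact_mod_cast Nat.lt_two_pow_self.le
  have hm' : (m : ℝ) < 2 ^ m := by exact_mod_cast Nat.lt_two_pow_self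
  have hr : (r : ℝ) + 1 ≤ 2 ^ r := by exact_mod_cast Nat.lt_two_pow_self
  -- The accuracy is `δ = 2⁻ᵈ`. The last bracket absorbs the Lipschitz bound for the cost; `t + 4 +
  -- m + r` leaves the `Λ` errors at most `2⁻⁽ᵗ⁺¹⁾` in total.
  set d := t + 4 + m + r + (m + r + r + u + b * r) with hd
  have hB1 : (1 : ℝ) ≤ 2 ^ b := one_le_pow₀ one_le_two
  have hd1 : (1 : ℝ) / 2 ^ d ≤ 1 := div_le_one_of_le₀ (one_le_pow₀ one_le_two) (by positivity)
  have hΛ : (m : ℝ) * ((r + 1) * (2 ^ u * ((r + 1) * (2 ^ b) ^ r)) * (1 / 2 ^ d)) ≤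
      2 ^ (m + r + r + u + b * r) / 2 ^ d := calc
    _ ≤ (2 : ℝ) ^ m * (2 ^ r * (2 ^ u * (2 ^ r * (2 ^ b) ^ r)) * (1 / 2 ^ d)) := by gcongr
    _ = _ := by rw [← pow_mul]; simp only [pow_add]; ring
  have ha : ((r : ℝ) + 1) * (2 ^ u * (2 ^ b) ^ r) ≤ 2 ^ (r + u + b * r) := calc
    _ ≤ (2 : ℝ) ^ r * (2 ^ u * (2 ^ b) ^ r) := by gcongr
    _ = _ := by rw [← pow_mul]; simp only [pow_add]; ring
  have hs : (m : ℝ) * (1 / 2 ^ (m + b + d * (r + 1) + u) * 2 ^ b) <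
      (1 / 2 ^ d) ^ (r + 1) / 2 ^ u := calc
    _ < (2 : ℝ) ^ m * (1 / 2 ^ (m + b + d * (r + 1) + u) * 2 ^ b) := by gcongr
    _ = _ := by
      rw [div_pow, one_pow, ← pow_mul, pow_add _ (m + b + d * (r + 1)), pow_add _ (m + b),
        pow_add _ m]
      field_simp
  -- The values of `η` and `γ` contribute at most `2⁻⁽ᵗ⁺²⁾` each.
  obtain ⟨A, hA⟩ := exists_algorithm_optimize N (η := 1 / 2 ^ (t + 2 + m + b))
    (γ := 1 / 2 ^ (t + 2)) (by positivity) (by positivity) hB1 hb (by positivity) (by positivity)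
    hΛ fun x hx k => exists_algorithm_enforce (by positivity) (by positivity) hB1 hb
      (by positivity) hd1 ha hs hx k
  refine ⟨A, fun l hl => ⟨(hA l hl).1.trans_eq ?_, fun f hf => ((hA l hl).2 f hf).trans ?_⟩⟩
  · simp [queryBound, hd, hm_def]
  · gcongr
    have h₁ : (m : ℝ) * (1 / 2 ^ (t + 2 + m + b) * 2 ^ b) ≤ 1 / 2 ^ (t + 2) := calc
      _ ≤ (2 : ℝ) ^ m * (1 / 2 ^ (t + 2 + m + b) * 2 ^ b) := by gcongr
      _ = _ := by rw [pow_add _ (t + 2 + m), pow_add _ (t + 2)]; field_simp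
    have h₂ : (4 * ((m : ℝ) * (r + 1)) + 1) * (2 ^ (m + r + r + u + b * r) / 2 ^ d) ≤
        1 / 2 ^ (t + 1) := calc
      _ ≤ (4 * ((2 : ℝ) ^ m * 2 ^ r) + 4 * (2 ^ m * 2 ^ r)) *
          (2 ^ (m + r + r + u + b * r) / 2 ^ d) := by
        have h3 : (1 : ℝ) ≤ 2 ^ m * 2 ^ r := by
          rw [← pow_add]; exact one_le_pow₀ one_le_two
        gcongr
        linarith
      _ = _ := by
        rw [hd, pow_add _ (t + 4 + m + r), pow_add _ (t + 4 + m), pow_add _ (t + 4),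
          pow_add _ t, pow_add _ t]
        field_simp
        ring
    have h₃ : (1 : ℝ) / 2 ^ (t + 2) + 1 / 2 ^ (t + 2) + 1 / 2 ^ (t + 1) = 1 / 2 ^ t := by
      rw [pow_add, pow_add]; field_simp; ring
    linarith

theorem queryBound_mono {m r b u t n : ℕ} (hm : m ≤ n) (hr : r ≤ n) (hb : b ≤ n) (hu : u ≤ n)
    (ht : t ≤ n) : queryBound m r b u t ≤ queryBound n n n n n := by
  unfold queryBound
  gcongr

theorem le_two_pow_clog_ceil (x : ℝ) : x ≤ 2 ^ Nat.clog 2 ⌈x⌉₊ :=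
  (Nat.le_ceil x).trans (by exact_mod_cast Nat.le_pow_clog one_lt_two _)

end Main

end RoutingGame

open RoutingGame in
theorem mainTheorem3 :
    ∃ p : Polynomial ℕ,
      ∀ (V E K : Type) [Fintype V] [Fintype E] [Fintype K] (N : Network V E K)
        (r : ℕ) (U ε : ℝ), 1 ≤ U → 0 < ε →
        ∃ A : Algorithm E, ∀ l : E → Polynomial ℝ, (∀ e, IsStandard r U (l e)) →
          (∀ τ : E → NNReal, ∃! x : E → ℝ, IsEquilibriumFlow N l τ x) ∧
          A.numQueries (oracle N l) ≤ p.eval (inputSize N r U + Nat.clog 2 ⌈1 / ε⌉₊) ∧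
          ∀ f : K → E → ℝ, IsFeasible N f →
            cost l (eqFlow N l (A.result (oracle N l))) ≤ cost l (edgeFlow f) + ε := by
  -- `queryBound` makes sense in any semiring: evaluated at `X` it is the polynomial, and at natural
  -- numbers the bound.
  refine ⟨queryBound .X .X .X .X .X, fun V E K _ _ _ N r U ε hU hε => ?_⟩
  obtain ⟨A, hA⟩ := exists_algorithm_queryBound N r (Nat.clog 2 ⌈∑ i, N.demand i⌉₊)
    (Nat.clog 2 ⌈U⌉₊) (Nat.clog 2 ⌈1 / ε⌉₊) (le_two_pow_clog_ceil _)
  have hU0 : 0 < U := one_pos.trans_le hU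
  refine ⟨A, fun l hl => ⟨fun τ => ?_, ?_, fun f hf => ?_⟩⟩
  · obtain ⟨x, hx⟩ := exists_isEquilibriumFlow N hl τ
    exact ⟨x, hx, fun y hy => IsEquilibriumFlow.unique hU0 hl hy hx⟩
  · refine ((hA l fun e => (hl e).mono hU0 (le_two_pow_clog_ceil U)).1.trans
      (queryBound_mono (n := inputSize N r U + Nat.clog 2 ⌈1 / ε⌉₊) ?_ ?_ ?_ ?_ ?_)).trans_eq ?_
    any_goals (unfold inputSize; omega)
    simp [queryBound]
  · refine ((hA l fun e => (hl e).mono hU0 (le_two_pow_clog_ceil U)).2 f hf).trans ?_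
    gcongr
    exact (one_div_le hε (by positivity)).1 (le_two_pow_clog_ceil (1 / ε))
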